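/- Let $d\ge 3$, let $\mathbb S^{d-1}$ be the unit sphere of $\mathbb R^d$ with its geodesic distance $\mathrm{dist}(x,y)=\arccos\langle x,y\rangle$, and let $\mathcal P(\mathbb S^{d-1})$ be the set of Borel probability measures on it. For $p\in[1,\infty]$ and $\mu,\nu\in\mathcal P(\mathbb S^{d-1})$ let $W_p(\mu,\nu)$ be the $p$-Wasserstein distance, that is, the infimum of $\|\mathrm{dist}(x,y)\|_{L^p(\gamma)}$ over all couplings $\gamma$ of $\mu$ and $\nu$ (for $p=\infty$ this is the $\gamma$-essential supremum of $\mathrm{dist}$). For $\beta>0$ define the interaction energy $$\mathsf E_\beta[\mu]=\frac1{2\beta}\iint e^{\beta\langle x,y\rangle}\,d\mu(x)\,d\mu(y),\qquad \mu\in\mathcal P(\mathbb S^{d-1}).$$ Then for every $\beta>0$ and every $p\in[1,\infty]$ (in particular for the usual distance $W_2$), every local maximum of $\mathsf E_\beta$ with respect to $W_p$ is a global maximum and a Dirac mass. That is, if $\mu\in\mathcal P(\mathbb S^{d-1})$ and there is $\varepsilon>0$ such that $\mathsf E_\beta[\nu]\le\mathsf E_\beta[\mu]$ for all $\nu\in\mathcal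 P(\mathbb S^{d-1})$ with $W_p(\mu,\nu)<\varepsilon$, then $\mathsf E_\beta[\nu]\le\mathsf E_\beta[\mu]$ for all $\nu\in\mathcal P(\mathbb S^{d-1})$, and $\mu=\delta_{x_0}$ for some $x_0\in\mathbb S^{d-1}$. -/

import Mathlib

open MeasureTheory
open scoped ENNReal

noncomputable section

/-- The unit sphere of `ℝ^d`. -/
abbrev UnitSphere (d : ℕ) : Type :=
  Metric.sphere (0 : EuclideanSpace ℝ (Fin d)) 1

/-- The geodesic distance on the unit sphere: the angle between two unit vectors. -/
def geodesicDist {d : ℕ} (x y : UnitSphere d) : ℝ :=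
  InnerProductGeometry.angle (x : EuclideanSpace ℝ (Fin d)) (y : EuclideanSpace ℝ (Fin d))

/-- The couplings of `μ` and `ν`: the measures on the product with marginals `μ` and `ν`. -/
def couplings {d : ℕ} (μ ν : ProbabilityMeasure (UnitSphere d)) :
    Set (Measure (UnitSphere d × UnitSphere d)) :=
  {γ | γ.fst = (μ : Measure (UnitSphere d)) ∧ γ.snd = (ν : Measure (UnitSphere d))}

/-- The `p`-Wasserstein distance on the probability measures on the sphere, for the geodesic
distance: the infimum over the couplings `γ` of the `L^p(γ)` norm of the distance
(the `γ`-essential supremum of the distance if `p = ∞`). -/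
def wassersteinDist {d : ℕ} (p : ℝ≥0∞) (μ ν : ProbabilityMeasure (UnitSphere d)) : ℝ≥0∞ :=
  ⨅ γ ∈ couplings μ ν, eLpNorm (fun z => geodesicDist z.1 z.2) p γ

/-- The interaction energy `(1 / 2β) ∬ exp (β ⟨x, y⟩) dμ(x) dμ(y)`. -/
def interactionEnergy {d : ℕ} (β : ℝ) (μ : ProbabilityMeasure (UnitSphere d)) : ℝ :=
  1 / (2 * β) *
    ∫ x, ∫ y, Real.exp (β * inner ℝ (x : EuclideanSpace ℝ (Fin d))
      (y : EuclideanSpace ℝ (Fin d))) ∂(μ : Measure (UnitSphere d)) ∂(μ : Measure (UnitSphere d))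

/-- `μ` maximizes `F` on some ball around `μ` for the `p`-Wasserstein distance. -/
def IsWassersteinLocalMax {d : ℕ} (p : ℝ≥0∞) (F : ProbabilityMeasure (UnitSphere d) → ℝ)
    (μ : ProbabilityMeasure (UnitSphere d)) : Prop :=
  ∃ ε : ℝ≥0∞, 0 < ε ∧ ∀ ν : ProbabilityMeasure (UnitSphere d),
    wassersteinDist p μ ν < ε → F ν ≤ F μ

end

/-! Push `μ` forward by the conformal flow of `x' = v - ⟨x, v⟩ x`. It divides `1 - ⟨x, y⟩` by a
product of one factor in `x` and one in `y` (`inner_mobiusFlowAux`), so the energy change is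
explicit. Averaging over `±t` removes the odd orders, and summing over an orthonormal basis of
directions `v` leaves a gain of order `sinh² t`, with coefficient proportional to `(1 - u)(d - 2 -
u)`, where `u = ⟨x, y⟩`. For `d ≥ 3` this is at least `(1 - u)²` (`sum_exp_inner_mobiusFlow_ge`).
The flow moves every point little, so a local maximum gains nothing. Hence `∬ e^{βu} (1 - u)²` is
`O(sinh² t)` (`integral_exp_mul_sq_le`), thus zero, and `u = 1` almost everywhere: `μ` is a Dirac
mass, which attains the bound `e^β / (2β)`. -/

open InnerProductGeometry Filter Topology

/-! ### Conformal flows of the sphere -/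

section MobiusFlow

variable {d : ℕ}

/-- The denominator of `mobiusFlow` is positive. -/
lemma cosh_add_mul_sinh_pos {a : ℝ} (ha : |a| ≤ 1) (t : ℝ) :
    0 < Real.cosh t + a * Real.sinh t := by
  have h1 := abs_le.1 ha
  have h2 := Real.exp_pos t
  have h3 := Real.exp_pos (-t)
  rw [Real.cosh_eq, Real.sinh_eq]
  rcases eq_or_lt_of_le h1.1 with h | h
  · rw [← h]; linarith
  · nlinarith

lemma abs_inner_sphere_le_one {v : EuclideanSpace ℝ (Fin d)} (hv : ‖v‖ = 1) (x : UnitSphere d) :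
    |inner ℝ (x : EuclideanSpace ℝ (Fin d)) v| ≤ 1 := by
  have h := abs_real_inner_le_norm (x : EuclideanSpace ℝ (Fin d)) v
  rwa [hv, norm_eq_of_mem_sphere x, one_mul] at h

/-- The time-`t` map of the flow `x' = v - ⟨x, v⟩ x`, as a map to the ambient space. -/
noncomputable def mobiusFlowAux (v : EuclideanSpace ℝ (Fin d)) (t : ℝ) (x : EuclideanSpace ℝ (Fin d)) :
    EuclideanSpace ℝ (Fin d) :=
  (Real.cosh t + inner ℝ x v * Real.sinh t)⁻¹ •
    (x + (Real.sinh t + (Real.cosh t - 1) * inner ℝ x v) • v)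

/-- Conformality: since `‖x - y‖² = 2(1 - ⟨x, y⟩)`, squared chords scale by one factor at each end.
Once denominators are cleared, only `cosh² = sinh² + 1` is used. -/
lemma inner_mobiusFlowAux {v : EuclideanSpace ℝ (Fin d)} (hv : ‖v‖ = 1) (t : ℝ)
    (x y : UnitSphere d) :
    inner ℝ (mobiusFlowAux v t x) (mobiusFlowAux v t y) =
      1 - (1 - inner ℝ (x : EuclideanSpace ℝ (Fin d)) (y : EuclideanSpace ℝ (Fin d))) /
        ((Real.cosh t + inner ℝ (x : EuclideanSpace ℝ (Fin d)) v * Real.sinh t) *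
          (Real.cosh t + inner ℝ (y : EuclideanSpace ℝ (Fin d)) v * Real.sinh t)) := by
  have hx := cosh_add_mul_sinh_pos (abs_inner_sphere_le_one hv x) t
  have hy := cosh_add_mul_sinh_pos (abs_inner_sphere_le_one hv y) t
  have hc := Real.cosh_sq t
  unfold mobiusFlowAux
  simp only [inner_smul_left, inner_smul_right, inner_add_left, inner_add_right,
    real_inner_self_eq_norm_sq, hv, real_inner_comm (y : EuclideanSpace ℝ (Fin d)) v,
    conj_trivial]
  generalize inner ℝ (x : EuclideanSpace ℝ (Fin d)) v = a at *
  generalize inner ℝ (y : EuclideanSpace ℝ (Fin d)) v = b at *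
  obtain ⟨A, hA⟩ : ∃ A, A = Real.cosh t + a * Real.sinh t := ⟨_, rfl⟩
  obtain ⟨B, hB⟩ : ∃ B, B = Real.cosh t + b * Real.sinh t := ⟨_, rfl⟩
  rw [← hA] at hx ⊢
  rw [← hB] at hy ⊢
  field_simp
  rw [hA, hB]
  linear_combination (-1 + a * b) * hc

lemma norm_mobiusFlowAux {v : EuclideanSpace ℝ (Fin d)} (hv : ‖v‖ = 1) (t : ℝ)
    (x : UnitSphere d) : ‖mobiusFlowAux v t x‖ = 1 := by
  have h := inner_mobiusFlowAux hv t x x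
  rw [real_inner_self_eq_norm_sq, real_inner_self_eq_norm_sq, norm_eq_of_mem_sphere x] at h
  have h2 : ‖mobiusFlowAux v t x‖ ^ 2 = 1 := by simpa using h
  nlinarith [norm_nonneg (mobiusFlowAux v t x)]

/-- The time-`t` map of the flow `x' = v - ⟨x, v⟩ x` on the sphere. -/
noncomputable def mobiusFlow (v : EuclideanSpace ℝ (Fin d)) (hv : ‖v‖ = 1) (t : ℝ) (x : UnitSphere d) :
    UnitSphere d :=
  ⟨mobiusFlowAux v t x, by simpa using norm_mobiusFlowAux hv t x⟩

lemma continuous_mobiusFlow (v : EuclideanSpace ℝ (Fin d)) (hv : ‖v‖ = 1) (t : ℝ) :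
    Continuous (mobiusFlow v hv t) := by
  have h1 : Continuous fun x : UnitSphere d =>
      Real.cosh t + inner ℝ (x : EuclideanSpace ℝ (Fin d)) v * Real.sinh t := by fun_prop
  have h2 : Continuous fun x : UnitSphere d => (x : EuclideanSpace ℝ (Fin d)) +
      (Real.sinh t + (Real.cosh t - 1) * inner ℝ (x : EuclideanSpace ℝ (Fin d)) v) • v := by
    fun_prop
  exact ((h1.inv₀ fun x =>
    (cosh_add_mul_sinh_pos (abs_inner_sphere_le_one hv x) t).ne').smul h2).subtype_mk _

lemma geodesicDist_eq_arccos (x y : UnitSphere d) :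
    geodesicDist x y =
      Real.arccos (inner ℝ (x : EuclideanSpace ℝ (Fin d)) (y : EuclideanSpace ℝ (Fin d))) := by
  simp [geodesicDist, angle, norm_eq_of_mem_sphere]

lemma continuous_geodesicDist :
    Continuous fun z : UnitSphere d × UnitSphere d => geodesicDist z.1 z.2 := by
  simp only [geodesicDist_eq_arccos]
  exact Real.continuous_arccos.comp (by fun_prop)

/-- The bound is uniform in `x` and `v` and vanishes as `t → 0`, which gives closeness even in
`W_∞`. -/
lemma geodesicDist_mobiusFlow_le (v : EuclideanSpace ℝ (Fin d)) (hv : ‖v‖ = 1) (t : ℝ)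
    (x : UnitSphere d) :
    geodesicDist x (mobiusFlow v hv t x) ≤
      Real.arccos (1 - (Real.cosh t - 1) * Real.exp |t|) := by
  rw [geodesicDist_eq_arccos]
  apply Real.arccos_le_arccos
  have ha := abs_inner_sphere_le_one hv x
  have hx := cosh_add_mul_sinh_pos ha t
  have hc := Real.one_le_cosh t
  simp only [mobiusFlow, mobiusFlowAux, inner_smul_right, inner_add_right,
    real_inner_self_eq_norm_sq, norm_eq_of_mem_sphere x]
  generalize inner ℝ (x : EuclideanSpace ℝ (Fin d)) v = a at *
  have h1 : Real.exp (-|t|) ≤ Real.cosh t + a * Real.sinh t := by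
    have h2 : |a * Real.sinh t| ≤ Real.sinh |t| := by
      rw [abs_mul, ← Real.abs_sinh]
      exact mul_le_of_le_one_left (abs_nonneg _) ha
    have h3 := (abs_le.1 h2).1
    rw [← Real.cosh_sub_sinh, Real.cosh_abs]
    linarith
  have h4 : (Real.cosh t + a * Real.sinh t)⁻¹ ≤ Real.exp |t| := by
    rw [inv_le_comm₀ hx (Real.exp_pos _), ← Real.exp_neg]
    exact h1
  have h5 : (Real.cosh t + a * Real.sinh t)⁻¹ *
      (1 ^ 2 + (Real.sinh t + (Real.cosh t - 1) * a) * a) =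
      1 - (Real.cosh t - 1) * ((1 - a ^ 2) * (Real.cosh t + a * Real.sinh t)⁻¹) := by
    field_simp
    ring
  rw [h5]
  have h6 : (1 - a ^ 2) * (Real.cosh t + a * Real.sinh t)⁻¹ ≤ Real.exp |t| :=
    (mul_le_of_le_one_left (inv_nonneg.2 hx.le) (by nlinarith)).trans h4
  have := mul_le_mul_of_nonneg_left h6 (sub_nonneg.2 hc)
  linarith

end MobiusFlow

/-! ### Wasserstein distance and energy of push-forwards -/

section Energy

variable {d : ℕ}

/-- Use the coupling carried by the graph of `T`; as its mass is one, a uniform bound controls every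
`L^p` norm. -/
lemma wassersteinDist_map_le (p : ℝ≥0∞) (μ : ProbabilityMeasure (UnitSphere d))
    {T : UnitSphere d → UnitSphere d} (hT : Continuous T) {C : ℝ}
    (hC : ∀ x, geodesicDist x (T x) ≤ C) :
    wassersteinDist p μ (μ.map hT.measurable.aemeasurable) ≤ ENNReal.ofReal C := by
  have hm : Measurable fun x => (x, T x) := measurable_id.prodMk hT.measurable
  have hγ : (μ : Measure (UnitSphere d)).map (fun x => (x, T x)) ∈
      couplings μ (μ.map hT.measurable.aemeasurable) := by
    constructor
    · rw [Measure.fst, Measure.map_map measurable_fst hm]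
      exact Measure.map_id
    · rw [Measure.snd, Measure.map_map measurable_snd hm]
      rfl
  refine (iInf₂_le _ hγ).trans ?_
  · rw [eLpNorm_map_measure continuous_geodesicDist.aestronglyMeasurable hm.aemeasurable]
    refine (eLpNorm_le_of_ae_bound (C := C) (ae_of_all _ fun x => ?_)).trans ?_
    · rw [Function.comp_apply, geodesicDist, Real.norm_of_nonneg (angle_nonneg _ _)]
      exact hC x
    · simp

lemma integrable_of_continuous_sphere {μ : Measure (UnitSphere d × UnitSphere d)}
    [IsFiniteMeasure μ] {f : UnitSphere d × UnitSphere d → ℝ} (hf : Continuous f) :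
    Integrable f μ :=
  hf.integrable_of_hasCompactSupport (HasCompactSupport.of_compactSpace _)

lemma interactionEnergy_map (β : ℝ) (μ : ProbabilityMeasure (UnitSphere d))
    {T : UnitSphere d → UnitSphere d} (hT : Continuous T) :
    interactionEnergy β (μ.map hT.measurable.aemeasurable) =
      1 / (2 * β) * ∫ z, Real.exp (β * inner ℝ (T z.1 : EuclideanSpace ℝ (Fin d))
        (T z.2 : EuclideanSpace ℝ (Fin d)))
          ∂((μ : Measure (UnitSphere d)).prod (μ : Measure (UnitSphere d))) := by
  have hf : Continuous fun z : UnitSphere d × UnitSphere d =>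
      Real.exp (β * inner ℝ (z.1 : EuclideanSpace ℝ (Fin d)) (z.2 : EuclideanSpace ℝ (Fin d))) := by
    fun_prop
  rw [interactionEnergy, ← integral_prod _ (integrable_of_continuous_sphere hf),
    ProbabilityMeasure.toMeasure_map, Measure.map_prod_map _ _ hT.measurable hT.measurable,
    integral_map (hT.measurable.prodMap hT.measurable).aemeasurable hf.aestronglyMeasurable]
  rfl

lemma interactionEnergy_eq_integral_prod (β : ℝ) (μ : ProbabilityMeasure (UnitSphere d)) :
    interactionEnergy β μ =
      1 / (2 * β) * ∫ z, Real.exp (β * inner ℝ (z.1 : EuclideanSpace ℝ (Fin d))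
        (z.2 : EuclideanSpace ℝ (Fin d)))
          ∂((μ : Measure (UnitSphere d)).prod (μ : Measure (UnitSphere d))) := by
  have hf : Continuous fun z : UnitSphere d × UnitSphere d =>
      Real.exp (β * inner ℝ (z.1 : EuclideanSpace ℝ (Fin d)) (z.2 : EuclideanSpace ℝ (Fin d))) := by
    fun_prop
  rw [interactionEnergy, ← integral_prod _ (integrable_of_continuous_sphere hf)]

lemma inner_sphere_le_one (x y : UnitSphere d) :
    inner ℝ (x : EuclideanSpace ℝ (Fin d)) (y : EuclideanSpace ℝ (Fin d)) ≤ 1 :=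
  (le_abs_self _).trans (abs_inner_sphere_le_one (norm_eq_of_mem_sphere y) x)

lemma interactionEnergy_le {β : ℝ} (hβ : 0 < β) (μ : ProbabilityMeasure (UnitSphere d)) :
    interactionEnergy β μ ≤ 1 / (2 * β) * Real.exp β := by
  rw [interactionEnergy_eq_integral_prod]
  refine mul_le_mul_of_nonneg_left ?_ (by positivity)
  have h := integral_mono (μ := (μ : Measure (UnitSphere d)).prod (μ : Measure (UnitSphere d)))
    (f := fun z => Real.exp (β * inner ℝ (z.1 : EuclideanSpace ℝ (Fin d))
        (z.2 : EuclideanSpace ℝ (Fin d)))) (g := fun _ => Real.exp β)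
    (integrable_of_continuous_sphere (by fun_prop)) (integrable_const _)
    (fun z => Real.exp_le_exp.2 (mul_le_of_le_one_right hβ.le (inner_sphere_le_one _ _)))
  simpa using h

lemma interactionEnergy_of_eq_dirac (β : ℝ) {μ : ProbabilityMeasure (UnitSphere d)}
    {x : UnitSphere d} (h : (μ : Measure (UnitSphere d)) = Measure.dirac x) :
    interactionEnergy β μ = 1 / (2 * β) * Real.exp β := by
  simp [interactionEnergy, h, norm_eq_of_mem_sphere]

end Energy

/-! ### Second-order gain along the flows -/

section SecondOrder

/-- Here `c = cosh t`, `h = sinh t`, and `a`, `b` are the components of `x`, `y` along `v`. With `m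
= 1 + ab`, `p = 1 - a²`, `q = 1 - b²`, `H = h²`, the sum is `2(1 + mH) / ((1 + pH)(1 + qH))`, whose
first-order coefficient in `H` is `2(m - p - q)`. The constant 12 is generous: the argument works
with 4. -/
lemma inv_mul_add_inv_mul_le {a b c h : ℝ} (ha : |a| ≤ 1) (hb : |b| ≤ 1)
    (hc : c ^ 2 = h ^ 2 + 1) (h1 : 0 < c + a * h) (h2 : 0 < c + b * h)
    (h3 : 0 < c + a * -h) (h4 : 0 < c + b * -h) :
    1 / ((c + a * h) * (c + b * h)) + 1 / ((c + a * -h) * (c + b * -h)) ≤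
      2 * (1 + (a * b + a ^ 2 + b ^ 2 - 1) * h ^ 2 + 12 * (h ^ 2) ^ 2) := by
  have hab : |a * b| ≤ 1 := by
    rw [abs_mul]; exact mul_le_one₀ ha (abs_nonneg _) hb
  have hab := abs_le.1 hab
  have ha2 : a ^ 2 ≤ 1 := (sq_le_one_iff_abs_le_one a).2 ha
  have hb2 : b ^ 2 ≤ 1 := (sq_le_one_iff_abs_le_one b).2 hb
  have e : 1 / ((c + a * h) * (c + b * h)) + 1 / ((c + a * -h) * (c + b * -h)) =
      2 * (1 + (1 + a * b) * h ^ 2) / ((1 + (1 - a ^ 2) * h ^ 2) * (1 + (1 - b ^ 2) * h ^ 2)) := by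
    have e1 : 1 + (1 - a ^ 2) * h ^ 2 = (c + a * h) * (c + a * -h) := by
      linear_combination -hc
    have e2 : 1 + (1 - b ^ 2) * h ^ 2 = (c + b * h) * (c + b * -h) := by
      linear_combination -hc
    have e3 : 2 * (1 + (1 + a * b) * h ^ 2) =
        (c + a * -h) * (c + b * -h) + (c + a * h) * (c + b * h) := by
      linear_combination -2 * hc
    rw [e1, e2, e3, div_add_div _ _ (mul_pos h1 h2).ne' (mul_pos h3 h4).ne']
    congr 1 <;> ring
  rw [e]
  have hp : 0 ≤ 1 - a ^ 2 := by linarith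
  have hq : 0 ≤ 1 - b ^ 2 := by linarith
  have hp1 : 1 - a ^ 2 ≤ 1 := by nlinarith
  have hq1 : 1 - b ^ 2 ≤ 1 := by nlinarith
  have hm : a * b + a ^ 2 + b ^ 2 - 1 = (1 + a * b) - (1 - a ^ 2) - (1 - b ^ 2) := by ring
  rw [hm]
  have hm0 : 0 ≤ 1 + a * b := by linarith
  have hm1 : 1 + a * b ≤ 2 := by linarith
  have hH := sq_nonneg h
  generalize 1 - a ^ 2 = p at *
  generalize 1 - b ^ 2 = q at *
  generalize 1 + a * b = m at *
  generalize h ^ 2 = H at *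
  rw [div_le_iff₀ (by positivity)]
  have hs0 : 0 ≤ p + q := by linarith
  have k1 : 1 + (p + q) * H ≤ (1 + p * H) * (1 + q * H) := by
    have : 0 ≤ p * q * H ^ 2 := by positivity
    linarith
  have k0 : 0 ≤ 1 + (m - p - q) * H + 12 * H ^ 2 := by
    nlinarith [mul_nonneg hm0 hH, mul_nonneg (by linarith : 0 ≤ 2 - p - q) hH, sq_nonneg (4 * H - 1)]
  have k2 : 1 + m * H ≤ (1 + (m - p - q) * H + 12 * H ^ 2) * (1 + (p + q) * H) := by
    have e3 : (1 + (m - p - q) * H + 12 * H ^ 2) * (1 + (p + q) * H) - (1 + m * H) =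
      H ^ 2 * (12 - (p + q) ^ 2 + m * (p + q) + 12 * (p + q) * H) := by ring
    have : 0 ≤ m * (p + q) := by positivity
    have : 0 ≤ 12 * (p + q) * H := by positivity
    have : 0 ≤ H ^ 2 * (12 - (p + q) ^ 2 + m * (p + q) + 12 * (p + q) * H) :=
      mul_nonneg (sq_nonneg _) (by nlinarith)
    linarith
  have := mul_le_mul_of_nonneg_left k1 k0
  linarith

variable {d : ℕ}

lemma norm_basisVec (i : Fin d) : ‖EuclideanSpace.single i (1 : ℝ)‖ = 1 := by simp

/-- The sum of the Gibbs weights over the flows along the coordinate axes, in both time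
directions, exceeds `2 d` times the original weight to second order. -/
lemma sum_exp_inner_mobiusFlow_ge (hd : 3 ≤ d) {β : ℝ} (hβ : 0 < β) (t : ℝ)
    (x y : UnitSphere d) :
    Real.exp (β * inner ℝ (x : EuclideanSpace ℝ (Fin d)) (y : EuclideanSpace ℝ (Fin d))) *
      (2 * d + 2 * β * Real.sinh t ^ 2 *
        (1 - inner ℝ (x : EuclideanSpace ℝ (Fin d)) (y : EuclideanSpace ℝ (Fin d))) ^ 2 -
          48 * β * d * (Real.sinh t ^ 2) ^ 2) ≤
    ∑ i : Fin d,
      (Real.exp (β * inner ℝ (mobiusFlow _ (norm_basisVec i) t x : EuclideanSpace ℝ (Fin d))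
          (mobiusFlow _ (norm_basisVec i) t y : EuclideanSpace ℝ (Fin d))) +
        Real.exp (β * inner ℝ (mobiusFlow _ (norm_basisVec i) (-t) x : EuclideanSpace ℝ (Fin d))
          (mobiusFlow _ (norm_basisVec i) (-t) y : EuclideanSpace ℝ (Fin d)))) := by
  have hd' : (3 : ℝ) ≤ d := by exact_mod_cast hd
  have hu1 := inner_sphere_le_one x y
  have hu0 := (abs_le.1 (abs_inner_sphere_le_one (norm_eq_of_mem_sphere y) x)).1
  have hsx : ∑ i, x.1 i ^ 2 = 1 := by
    rw [← EuclideanSpace.real_norm_sq_eq, norm_eq_of_mem_sphere x, one_pow]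
  have hsy : ∑ i, y.1 i ^ 2 = 1 := by
    rw [← EuclideanSpace.real_norm_sq_eq, norm_eq_of_mem_sphere y, one_pow]
  have hsxy : ∑ i, x.1 i * y.1 i = inner ℝ x.1 y.1 := by
    simp [PiLp.inner_apply, mul_comm]
  have hterm : ∀ i : Fin d,
      Real.exp (β * inner ℝ x.1 y.1) * (2 + 2 * β * (1 - inner ℝ x.1 y.1) *
        -((x.1 i * y.1 i + x.1 i ^ 2 + y.1 i ^ 2 - 1) * Real.sinh t ^ 2
          + 12 * (Real.sinh t ^ 2) ^ 2)) ≤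
      Real.exp (β * inner ℝ (mobiusFlow _ (norm_basisVec i) t x : EuclideanSpace ℝ (Fin d))
          (mobiusFlow _ (norm_basisVec i) t y : EuclideanSpace ℝ (Fin d))) +
        Real.exp (β * inner ℝ (mobiusFlow _ (norm_basisVec i) (-t) x : EuclideanSpace ℝ (Fin d))
          (mobiusFlow _ (norm_basisVec i) (-t) y : EuclideanSpace ℝ (Fin d))) := by
    intro i
    have hx := abs_inner_sphere_le_one (norm_basisVec i) x
    have hy := abs_inner_sphere_le_one (norm_basisVec i) y
    have key := inv_mul_add_inv_mul_le hx hy (Real.cosh_sq t)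
      (cosh_add_mul_sinh_pos hx t) (cosh_add_mul_sinh_pos hy t)
      (by simpa using cosh_add_mul_sinh_pos hx (-t))
      (by simpa using cosh_add_mul_sinh_pos hy (-t))
    -- Convexity: the tangent line of `exp` suffices, so no second-order term of the exponential is
    -- needed.
    have hexp : ∀ w : ℝ, Real.exp (β * inner ℝ x.1 y.1) *
        (1 + β * (1 - inner ℝ x.1 y.1) * (1 - w)) ≤
          Real.exp (β * (1 - (1 - inner ℝ x.1 y.1) * w)) := by
      intro w
      have e : β * (1 - (1 - inner ℝ x.1 y.1) * w) =
        β * inner ℝ x.1 y.1 + β * (1 - inner ℝ x.1 y.1) * (1 - w) := by ring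
      rw [e, Real.exp_add]
      refine mul_le_mul_of_nonneg_left ?_ (Real.exp_pos _).le
      linarith [Real.add_one_le_exp (β * (1 - inner ℝ x.1 y.1) * (1 - w))]
    simp only [mobiusFlow, inner_mobiusFlowAux (norm_basisVec i)]
    simp only [Real.cosh_neg, Real.sinh_neg, div_eq_mul_one_div (1 - inner ℝ x.1 y.1)]
    refine le_trans ?_ (add_le_add (hexp _) (hexp _))
    rw [← mul_add]
    refine mul_le_mul_of_nonneg_left ?_ (Real.exp_pos _).le
    have hi : ∀ z : UnitSphere d, inner ℝ z.1 (EuclideanSpace.single i (1 : ℝ)) = z.1 i := by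
      simp [EuclideanSpace.inner_single_right]
    simp only [hi] at key ⊢
    have := mul_le_mul_of_nonneg_left key
      (mul_nonneg hβ.le (sub_nonneg.2 hu1))
    linarith
  refine le_trans ?_ (Finset.sum_le_sum fun i _ => hterm i)
  rw [← Finset.mul_sum]
  refine mul_le_mul_of_nonneg_left ?_ (Real.exp_pos _).le
  have hsum : ∑ i : Fin d, (2 + 2 * β * (1 - inner ℝ x.1 y.1) *
        -((x.1 i * y.1 i + x.1 i ^ 2 + y.1 i ^ 2 - 1) * Real.sinh t ^ 2
          + 12 * (Real.sinh t ^ 2) ^ 2)) =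
      2 * d + 2 * β * (1 - inner ℝ x.1 y.1) *
        -((inner ℝ x.1 y.1 + 1 + 1 - d) * Real.sinh t ^ 2 + 12 * d * (Real.sinh t ^ 2) ^ 2) := by
    rw [Finset.sum_add_distrib, ← Finset.mul_sum, Finset.sum_neg_distrib, Finset.sum_add_distrib,
      ← Finset.sum_mul, Finset.sum_sub_distrib, Finset.sum_add_distrib, Finset.sum_add_distrib,
      hsx, hsy, hsxy]
    simp
    ring
  rw [hsum]
  generalize inner ℝ x.1 y.1 = u at *
  have hH := sq_nonneg (Real.sinh t)
  generalize Real.sinh t ^ 2 = H at *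
  -- The dimension enters through `d - 2 - u = (1 - u) + (d - 3)`.
  have k1 : 0 ≤ 2 * β * (1 - u) * ((d - 3) * H) :=
    mul_nonneg (mul_nonneg (by linarith) (by linarith)) (mul_nonneg (by linarith) hH)
  have k2 : 0 ≤ 24 * β * d * H ^ 2 * (1 + u) :=
    mul_nonneg (by positivity) (by linarith)
  linarith

end SecondOrder

/-! ### Local maxima are Dirac masses -/

section Conclusion

variable {d : ℕ}

/-- By Fubini some `x` satisfies `⟨x, y⟩ = 1` for almost every `y`; equality in Cauchy–Schwarz
forces `y = x`. -/
lemma exists_eq_dirac_of_ae_inner_eq_one (μ : ProbabilityMeasure (UnitSphere d))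
    (h : ∀ᵐ z ∂((μ : Measure (UnitSphere d)).prod (μ : Measure (UnitSphere d))),
      inner ℝ (z.1 : EuclideanSpace ℝ (Fin d)) (z.2 : EuclideanSpace ℝ (Fin d)) = 1) :
    ∃ x₀ : UnitSphere d, (μ : Measure (UnitSphere d)) = Measure.dirac x₀ := by
  obtain ⟨x, hx⟩ := (Measure.ae_ae_of_ae_prod h).exists
  refine ⟨x, ?_⟩
  have hx' : ∀ᵐ y ∂(μ : Measure (UnitSphere d)), y = x := by
    filter_upwards [hx] with y hy
    exact Subtype.ext ((inner_eq_one_iff_of_norm_eq_one (norm_eq_of_mem_sphere x)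
      (norm_eq_of_mem_sphere y)).1 hy).symm
  calc (μ : Measure (UnitSphere d)) = (μ : Measure (UnitSphere d)).map id := Measure.map_id.symm
    _ = (μ : Measure (UnitSphere d)).map fun _ => x := Measure.map_congr hx'
    _ = Measure.dirac x := by simp

lemma exists_wassersteinDist_mobiusFlow_lt (p : ℝ≥0∞) {ε : ℝ≥0∞} (hε : 0 < ε) :
    ∀ᶠ t in 𝓝 (0 : ℝ), ∀ (μ : ProbabilityMeasure (UnitSphere d))
      (v : EuclideanSpace ℝ (Fin d)) (hv : ‖v‖ = 1),
      wassersteinDist p μ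
        (μ.map (continuous_mobiusFlow v hv t).measurable.aemeasurable) < ε := by
  have hc : Continuous fun t : ℝ =>
      ENNReal.ofReal (Real.arccos (1 - (Real.cosh t - 1) * Real.exp |t|)) :=
    ENNReal.continuous_ofReal.comp (Real.continuous_arccos.comp (by fun_prop))
  have h0 := hc.tendsto 0
  simp only [Real.cosh_zero, sub_self, zero_mul, sub_zero, Real.arccos_one,
    ENNReal.ofReal_zero] at h0
  filter_upwards [h0.eventually (gt_mem_nhds hε)] with t ht μ v hv
  exact (wassersteinDist_map_le p μ (continuous_mobiusFlow v hv t) (geodesicDist_mobiusFlow_le v hv t)).trans_lt ht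

/-- If the flows along the coordinate axes do not increase the energy, then the spread of `μ`
is controlled by the squared flow time. -/
lemma integral_exp_mul_sq_le (hd : 3 ≤ d) {β : ℝ} (hβ : 0 < β)
    {t : ℝ} (ht0 : t ≠ 0) (μ : ProbabilityMeasure (UnitSphere d))
    (h : ∀ (s : ℝ) (_ : s = t ∨ s = -t) (v : EuclideanSpace ℝ (Fin d)) (hv : ‖v‖ = 1),
      interactionEnergy β (μ.map (continuous_mobiusFlow v hv s).measurable.aemeasurable) ≤
        interactionEnergy β μ) :
    ∫ z, Real.exp (β * inner ℝ (z.1 : EuclideanSpace ℝ (Fin d))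
        (z.2 : EuclideanSpace ℝ (Fin d))) *
        (1 - inner ℝ (z.1 : EuclideanSpace ℝ (Fin d)) (z.2 : EuclideanSpace ℝ (Fin d))) ^ 2
          ∂((μ : Measure (UnitSphere d)).prod (μ : Measure (UnitSphere d))) ≤
      24 * d * Real.sinh t ^ 2 * ∫ z, Real.exp (β * inner ℝ (z.1 : EuclideanSpace ℝ (Fin d))
        (z.2 : EuclideanSpace ℝ (Fin d)))
          ∂((μ : Measure (UnitSphere d)).prod (μ : Measure (UnitSphere d))) := by
  set P := (μ : Measure (UnitSphere d)).prod (μ : Measure (UnitSphere d)) with hP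
  set e : UnitSphere d × UnitSphere d → ℝ := fun z =>
    Real.exp (β * inner ℝ (z.1 : EuclideanSpace ℝ (Fin d)) (z.2 : EuclideanSpace ℝ (Fin d)))
    with he
  set q : UnitSphere d × UnitSphere d → ℝ := fun z => e z *
    (1 - inner ℝ (z.1 : EuclideanSpace ℝ (Fin d)) (z.2 : EuclideanSpace ℝ (Fin d))) ^ 2 with hq
  let g : Fin d → ℝ → UnitSphere d × UnitSphere d → ℝ := fun i s z =>
    e (mobiusFlow _ (norm_basisVec i) s z.1, mobiusFlow _ (norm_basisVec i) s z.2)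
  have hec : Continuous e := by fun_prop
  have hqc : Continuous q := by fun_prop
  have hgc : ∀ i s, Continuous (g i s) := fun i s =>
    hec.comp (((continuous_mobiusFlow _ _ s).comp continuous_fst).prodMk
      ((continuous_mobiusFlow _ _ s).comp continuous_snd))
  have hg : ∀ i s, s = t ∨ s = -t → ∫ z, g i s z ∂P ≤ ∫ z, e z ∂P := by
    intro i s hs
    have h1 := h s hs _ (norm_basisVec i)
    rw [interactionEnergy_map β μ (continuous_mobiusFlow _ _ s),
      interactionEnergy_eq_integral_prod] at h1
    exact le_of_mul_le_mul_left h1 (by positivity)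
  have h2 : ∫ z, ((2 * d - 48 * β * d * (Real.sinh t ^ 2) ^ 2) * e z +
      2 * β * Real.sinh t ^ 2 * q z) ∂P ≤ ∫ z, ∑ i, (g i t z + g i (-t) z) ∂P := by
    refine integral_mono (integrable_of_continuous_sphere (by fun_prop))
      (integrable_of_continuous_sphere (by fun_prop)) fun z => ?_
    refine le_trans (le_of_eq ?_) (sum_exp_inner_mobiusFlow_ge hd hβ t z.1 z.2)
    simp only [hq, he]
    ring
  rw [integral_add ((integrable_of_continuous_sphere hec).const_mul _)
    ((integrable_of_continuous_sphere hqc).const_mul _), integral_const_mul, integral_const_mul,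
    integral_finsetSum _ fun i _ => integrable_of_continuous_sphere (by fun_prop)] at h2
  have h3 : ∑ i, ∫ z, (g i t z + g i (-t) z) ∂P ≤ ∑ _i : Fin d, 2 * ∫ z, e z ∂P := by
    refine Finset.sum_le_sum fun i _ => ?_
    rw [integral_add (integrable_of_continuous_sphere (hgc i t))
      (integrable_of_continuous_sphere (hgc i (-t)))]
    linarith [hg i t (Or.inl rfl), hg i (-t) (Or.inr rfl)]
  simp only [Finset.sum_const, Finset.card_univ, Fintype.card_fin, nsmul_eq_mul] at h3
  have hs : 0 < Real.sinh t ^ 2 := by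
    have := Real.sinh_eq_zero.not.2 ht0
    positivity
  -- The constant `24 d` is the error coefficient `48 β d` divided by the gain coefficient `2 β`.
  refine le_of_mul_le_mul_left ?_ (by positivity : 0 < 2 * β * Real.sinh t ^ 2)
  linarith

theorem mainTheorem4 (d : ℕ) (hd : 3 ≤ d) (β : ℝ) (hβ : 0 < β) (p : ℝ≥0∞) (hp : 1 ≤ p)
    (μ : ProbabilityMeasure (UnitSphere d))
    (hμ : IsWassersteinLocalMax p (interactionEnergy β) μ) :
    (∀ ν : ProbabilityMeasure (UnitSphere d), interactionEnergy β ν ≤ interactionEnergy β μ) ∧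
      ∃ x₀ : UnitSphere d, (μ : Measure (UnitSphere d)) = Measure.dirac x₀ := by
  have hdirac : ∃ x₀ : UnitSphere d, (μ : Measure (UnitSphere d)) = Measure.dirac x₀ := by
    obtain ⟨ε, hε, hmax⟩ := hμ
    have hnear := exists_wassersteinDist_mobiusFlow_lt (d := d) p hε
    have hnear' := (continuous_neg.tendsto' (0 : ℝ) 0 neg_zero).eventually hnear
    have hsinh : Tendsto (fun t : ℝ => Real.sinh t ^ 2) (𝓝 0) (𝓝 0) := by
      exact (Real.continuous_sinh.pow 2).tendsto' 0 0 (by simp)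
    have hqc : Continuous fun z : UnitSphere d × UnitSphere d =>
        Real.exp (β * inner ℝ (z.1 : EuclideanSpace ℝ (Fin d))
          (z.2 : EuclideanSpace ℝ (Fin d))) *
        (1 - inner ℝ (z.1 : EuclideanSpace ℝ (Fin d)) (z.2 : EuclideanSpace ℝ (Fin d))) ^ 2 := by
      fun_prop
    have hle : ∫ z, Real.exp (β * inner ℝ (z.1 : EuclideanSpace ℝ (Fin d))
          (z.2 : EuclideanSpace ℝ (Fin d))) *
        (1 - inner ℝ (z.1 : EuclideanSpace ℝ (Fin d)) (z.2 : EuclideanSpace ℝ (Fin d))) ^ 2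
          ∂((μ : Measure (UnitSphere d)).prod (μ : Measure (UnitSphere d))) ≤ 0 := by
      have hlim := (hsinh.const_mul (24 * (d : ℝ))).mul_const
        (∫ z, Real.exp (β * inner ℝ (z.1 : EuclideanSpace ℝ (Fin d))
          (z.2 : EuclideanSpace ℝ (Fin d)))
            ∂((μ : Measure (UnitSphere d)).prod (μ : Measure (UnitSphere d))))
      rw [mul_zero, zero_mul] at hlim
      -- The left side does not depend on `t`; the limit is over `t ≠ 0` because the estimate was
      -- divided by `sinh² t`.
      refine ge_of_tendsto (hlim.mono_left (nhdsWithin_le_nhds (s := {0}ᶜ))) ?_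
      filter_upwards [self_mem_nhdsWithin, nhdsWithin_le_nhds hnear, nhdsWithin_le_nhds hnear']
        with t ht0 h1 h2
      refine integral_exp_mul_sq_le hd hβ ht0 μ ?_
      rintro s (rfl | rfl) v hv
      · exact hmax _ (h1 μ v hv)
      · exact hmax _ (h2 μ v hv)
    have hnonneg : ∀ z : UnitSphere d × UnitSphere d,
        0 ≤ Real.exp (β * inner ℝ (z.1 : EuclideanSpace ℝ (Fin d))
          (z.2 : EuclideanSpace ℝ (Fin d))) *
        (1 - inner ℝ (z.1 : EuclideanSpace ℝ (Fin d)) (z.2 : EuclideanSpace ℝ (Fin d))) ^ 2 :=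
      fun z => by positivity
    have hzero := (integral_eq_zero_iff_of_nonneg hnonneg
      (integrable_of_continuous_sphere hqc)).1 (le_antisymm hle (integral_nonneg hnonneg))
    apply exists_eq_dirac_of_ae_inner_eq_one
    filter_upwards [hzero] with z hz
    have hz' := (mul_eq_zero.1 hz).resolve_left (Real.exp_ne_zero _)
    linarith [pow_eq_zero_iff two_ne_zero |>.1 hz']
  refine ⟨fun ν => ?_, hdirac⟩
  obtain ⟨x₀, hx₀⟩ := hdirac
  rw [interactionEnergy_of_eq_dirac β hx₀]
  exact interactionEnergy_le hβ ν

end Conclusion
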